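/- \textbf{Setting.} A gentle quiver $(Q,R)$ is a finite quiver $Q=(Q_0,Q_1,s,t)$ with a set $R$ of paths of length two (for $t(q)=s(r)$ write $qr=0$ if $qr\in R$ and $qr\neq 0$ otherwise) such that every vertex has at most two incoming and at most two outgoing arrows, and for every arrow $q$ there is at most one arrow $r$ with $t(q)=s(r)$, $qr\neq0$, at most one with $t(q)=s(r)$, $qr=0$, at most one with $t(r)=s(q)$, $rq\neq0$, and at most one with $t(r)=s(q)$, $rq=0$. A blossoming of $(Q,R)$ is a gentle quiver $(Q',R')$ containing $Q$ as a subquiver, such that a path of length two of $Q$ is in $R'$ if and only if it is in $R$; every arrow of $Q'$ not in $Q$ has exactly one of its two endpoints in $Q_0$; every $i\in Q_0$ is the source of exactly two and the target of exactly two arrows of $Q'$; every vertex in $Q'_0\setminus Q_0$ is the source of at most one and the target of at most one arrow of $Q'$; and $qr\in R'$ whenever $t(q)=s(r)\in Q_0'\setminus Q_0$. Let $(Q,R)$ be a gentle quiver and $(Q',R')$ a blossoming of it. Letters are the arrows $q$ of $Q'$ and their formal inverses $q^-$, with $s(q^-)=t(q)$, $t(q^-)=s(q)$. The product of two letters is non-zero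 exactly in the following cases: $qr$ and $r^-q^-$, for arrows $q,r$ with $t(q)=s(r)$ and $qr\notin R'$; $qr^-$, for arrows $q\neq r$ with $t(q)=t(r)$; $q^-r$, for arrows $q\neq r$ with $s(q)=s(r)$. A (non-stationary) walk is a non-empty word of letters, indexed by a possibly infinite interval of $\mathbb Z$ (up to translation of the indices), in which consecutive letters have non-zero product; a stationary walk is a symbol $e_{x,y}$ with $x,y$ arrows of $Q'$ such that $xy\neq0$. The string $\overline\gamma$ of a walk $\gamma$ is $\{\gamma,\gamma^-\}$, where $\gamma^-$ is the inverse word. A walk is infinite if it is unbounded to the left or its first letter has source in $Q'_0\setminus Q_0$, and it is unbounded to the right or its last letter has target in $Q_0'\setminus Q_0$; it is periodic if it is unbounded at both ends and invariant under a non-zero translation of indices; an infinite walk is null if all its letters are arrows or all its letters are inverses of arrows. A string is infinite, periodic or null if its underlying walks are. For walks $\gamma,\delta$, let $c^+(\gamma,\delta)$ be the set of positive crossings from $\gamma$ to $\delta$, that is, of pairs of decompositions \[\gamma=\gamma_1q^-\,\omega\,q'\gamma_2,\qquad \delta=\delta_1r\,\omega\,r'^-\delta_2\] with $q,q',r,r'$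 arrows and $\omega$ a common confined (possibly stationary) subwalk; for $\omega=e_{x,y}$ stationary this means that $q^-q'$ and $rr'^-$ are consecutive letters in $\gamma$ and $\delta$ and that $q^-y$, $ry$, $xq'$, $xr'^-$ are all non-zero. Here $\gamma_1,\gamma_2,\delta_1,\delta_2$ may be absent. Put $c^+(\overline\gamma,\overline\delta)=c^+(\gamma,\delta)\sqcup c^+(\gamma,\delta^-)$. A set $\mathscr S$ of strings is non-crossing if $c^+(\sigma,\tau)=\emptyset$ for all $\sigma,\tau\in\mathscr S$ (including $\sigma=\tau$). Let $\mathsf{MNC}$ be the set of maximal non-crossing sets, i.e. of the sets that are maximal among the non-crossing sets consisting only of infinite strings. The crossing order on $\mathsf{MNC}$ is: $\mathscr S'\le\mathscr S$ if $c^+(\sigma',\sigma)=\emptyset$ for all $\sigma'\in\mathscr S'$, $\sigma\in\mathscr S$. Let $B$ be a set. For $\mathscr S\in\mathsf{MNC}$ let $\mathscr S^p$ be the set of non-null periodic strings in $\mathscr S$. A $B$-parametrised maximal non-crossing set is a pair $(\mathscr S,\lambda)$ with $\mathscr S\in\mathsf{MNC}$ and $\lambda:\mathscr S^p\to 2^B$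 a map. Let $\mathsf{MNC}_B$ be the set of these pairs, with the relation: $(\mathscr S',\lambda')\le(\mathscr S,\lambda)$ if $\mathscr S'\le\mathscr S$ and $\lambda'(\sigma)\subseteq\lambda(\sigma)$ for all $\sigma\in\mathscr S^p\cap\mathscr S'^p$. \textbf{Proposition.} The crossing order makes $\mathsf{MNC}$ a complete lattice, and the relation $\le$ makes $\mathsf{MNC}_B$ a complete lattice. For every family $(\mathscr S_i,\lambda_i)_{i\in I}$ in $\mathsf{MNC}_B$, the join is $(\mathscr S_\vee,\lambda_\vee)$ and the meet is $(\mathscr S_\wedge,\lambda_\wedge)$, where \[\mathscr S_\vee=\bigvee_{i\in I}\mathscr S_i,\quad \lambda_\vee(\sigma)=\bigcup_{i\in I:\ \sigma\in\mathscr S_i}\lambda_i(\sigma)\ \ (\sigma\in\mathscr S_\vee^p),\] \[\mathscr S_\wedge=\bigwedge_{i\in I}\mathscr S_i,\quad \lambda_\wedge(\sigma)=\bigcap_{i\in I:\ \sigma\in\mathscr S_i}\lambda_i(\sigma)\ \ (\sigma\in\mathscr S_\wedge^p),\] the joins and meets of the $\mathscr S_i$ are taken in $\mathsf{MNC}$,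 and the intersection over an empty index set is $B$. -/

import Mathlib

universe u v u' v' w b

namespace GentleStrings

/-- A quiver `(Q₀, Q₁, s, t)` with vertex set `V` and arrow set `A`, together with a set `rel`
of paths of length two: `(q, r) ∈ rel` means that the path `qr` (first `q`, then `r`) is a
relation, which we write `qr = 0`. -/
structure BoundQuiver (V : Type u) (A : Type v) where
  src : A → V
  tgt : A → V
  rel : Set (A × A)
  rel_path : ∀ q r, (q, r) ∈ rel → tgt q = src r

/-- `(Q, R)` is a gentle quiver (it need not be finite-dimensional, that is, oriented cycles
without relations are allowed). -/
structure BoundQuiver.IsGentle {V : Type u} {A : Type v} (Q : BoundQuiver V A) : Prop where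
  finite_vertices : Finite V
  finite_arrows : Finite A
  in_le_two : ∀ i : V, {q | Q.tgt q = i}.encard ≤ 2
  out_le_two : ∀ i : V, {q | Q.src q = i}.encard ≤ 2
  right_nonzero : ∀ q : A, {r | Q.tgt q = Q.src r ∧ (q, r) ∉ Q.rel}.Subsingleton
  right_zero : ∀ q : A, {r | Q.tgt q = Q.src r ∧ (q, r) ∈ Q.rel}.Subsingleton
  left_nonzero : ∀ q : A, {r | Q.tgt r = Q.src q ∧ (r, q) ∉ Q.rel}.Subsingleton
  left_zero : ∀ q : A, {r | Q.tgt r = Q.src q ∧ (r, q) ∈ Q.rel}.Subsingleton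

/-- `(Q', R')` is a blossoming of `(Q, R)`, where `Q₀ ⊆ Q'₀` and `Q₁ ⊆ Q'₁` are realised by the
injections `f` and `g`. -/
structure IsBlossoming {V : Type u} {A : Type v} {V' : Type u'} {A' : Type v'}
    (Q : BoundQuiver V A) (Q' : BoundQuiver V' A') (f : V → V') (g : A → A') : Prop where
  isGentle : Q'.IsGentle
  injective_vertices : Function.Injective f
  injective_arrows : Function.Injective g
  src_map : ∀ q : A, Q'.src (g q) = f (Q.src q)
  tgt_map : ∀ q : A, Q'.tgt (g q) = f (Q.tgt q)
  rel_map : ∀ q r : A, (g q, g r) ∈ Q'.rel ↔ (q, r) ∈ Q.rel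
  /-- a new arrow joins an old vertex and a new vertex -/
  new_arrow : ∀ q : A', q ∉ Set.range g →
    Xor (Q'.src q ∈ Set.range f) (Q'.tgt q ∈ Set.range f)
  out_eq_two : ∀ i : V, {q | Q'.src q = f i}.encard = 2
  in_eq_two : ∀ i : V, {q | Q'.tgt q = f i}.encard = 2
  rel_new : ∀ q r : A', Q'.tgt q = Q'.src r → Q'.tgt q ∉ Set.range f → (q, r) ∈ Q'.rel
  new_out_le_one : ∀ i : V', i ∉ Set.range f → {q | Q'.src q = i}.Subsingleton
  new_in_le_one : ∀ i : V', i ∉ Set.range f → {q | Q'.tgt q = i}.Subsingleton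

/-- A letter: an arrow `q` or a formal inverse `q⁻`. -/
inductive Letter (A : Type v) : Type v
  | arrow (q : A) : Letter A
  | inv (q : A) : Letter A

namespace Letter

variable {V : Type u} {A : Type v}

/-- The formal inverse of a letter. -/
def rev : Letter A → Letter A
  | arrow q => inv q
  | inv q => arrow q

theorem rev_rev (α : Letter A) : α.rev.rev = α := by
  cases α <;> rfl

/-- The source of a letter. -/
def src (Q : BoundQuiver V A) : Letter A → V
  | arrow q => Q.src q
  | inv q => Q.tgt q

/-- The target of a letter. -/
def tgt (Q : BoundQuiver V A) : Letter A → V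
  | arrow q => Q.tgt q
  | inv q => Q.src q

/-- `Composable Q α β` says that the product `αβ` of two letters is defined and non-zero. -/
def Composable (Q : BoundQuiver V A) : Letter A → Letter A → Prop
  | arrow q, arrow r => Q.tgt q = Q.src r ∧ (q, r) ∉ Q.rel
  | inv r, inv q => Q.tgt q = Q.src r ∧ (q, r) ∉ Q.rel
  | arrow q, inv r => Q.tgt q = Q.tgt r ∧ q ≠ r
  | inv q, arrow r => Q.src q = Q.src r ∧ q ≠ r

end Letter

/-- A non-stationary walk: a non-empty word of letters indexed by an interval of `ℤ` (the set of
all `i` with `letter i ≠ none`), such that consecutive letters have non-zero product.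
(Stationary walks enter below only as possible overlaps in crossings; they are never infinite.) -/
structure Walk {V : Type u} {A : Type v} (Q : BoundQuiver V A) where
  letter : ℤ → Option (Letter A)
  nonempty : ∃ i, letter i ≠ none
  interval : {i | letter i ≠ none}.OrdConnected
  composable : ∀ i α β, letter i = some α → letter (i + 1) = some β → Letter.Composable Q α β

namespace Walk

variable {V : Type u} {A : Type v} {Q : BoundQuiver V A}

/-- Two walks define the same string if they agree, as words, up to inversion. Words are
considered up to a translation of their indices. -/
def SameString (γ δ : Walk Q) : Prop :=
  (∃ n : ℤ, ∀ i, δ.letter i = γ.letter (i + n)) ∨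
    (∃ n : ℤ, ∀ i, δ.letter i = (γ.letter (n - i)).map Letter.rev)

theorem map_rev_rev (o : Option (Letter A)) :
    (o.map Letter.rev).map Letter.rev = o := by
  cases o <;> simp [Letter.rev_rev]

theorem sameString_equivalence : Equivalence (SameString (Q := Q)) where
  refl γ := Or.inl ⟨0, fun i => by simp⟩
  symm := by
    rintro γ δ (⟨n, h⟩ | ⟨n, h⟩)
    · exact Or.inl ⟨-n, fun i => by rw [h]; congr 1; ring⟩
    · refine Or.inr ⟨n, fun i => ?_⟩
      rw [h, map_rev_rev]; congr 1; ring
  trans := by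
    rintro γ δ ε (⟨n, h⟩ | ⟨n, h⟩) (⟨m, k⟩ | ⟨m, k⟩)
    · exact Or.inl ⟨m + n, fun i => by rw [k, h]; congr 1; ring⟩
    · refine Or.inr ⟨m + n, fun i => ?_⟩
      rw [k, h]; congr 2; ring
    · refine Or.inr ⟨n - m, fun i => ?_⟩
      rw [k, h]; congr 2; ring
    · refine Or.inl ⟨n - m, fun i => ?_⟩
      rw [k, h, map_rev_rev]; congr 1; ring

/-- Left-infinite: unbounded to the left, or there is a first letter and it starts at a vertex
outside the set `O` of old vertices. -/
def LeftInfinite (O : Set V) (γ : Walk Q) : Prop :=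
  (∀ i, ∃ j < i, γ.letter j ≠ none) ∨
    ∃ i α, γ.letter i = some α ∧ γ.letter (i - 1) = none ∧ α.src Q ∉ O

/-- Right-infinite: unbounded to the right, or there is a last letter and it ends at a vertex
outside the set `O` of old vertices. -/
def RightInfinite (O : Set V) (γ : Walk Q) : Prop :=
  (∀ i, ∃ j > i, γ.letter j ≠ none) ∨
    ∃ i α, γ.letter i = some α ∧ γ.letter (i + 1) = none ∧ α.tgt Q ∉ O

/-- A walk is infinite if it is left-infinite and right-infinite. -/
def IsInfinite (O : Set V) (γ : Walk Q) : Prop :=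
  γ.LeftInfinite O ∧ γ.RightInfinite O

/-- A walk is periodic if it is unbounded at both ends and invariant under a non-zero
translation. -/
def IsPeriodic (γ : Walk Q) : Prop :=
  (∀ i, γ.letter i ≠ none) ∧ ∃ r : ℤ, r ≠ 0 ∧ ∀ i, γ.letter (i + r) = γ.letter i

/-- A walk is null if all its letters are arrows or all its letters are inverses of arrows. -/
def IsNull (γ : Walk Q) : Prop :=
  (∀ i α, γ.letter i = some α → ∃ q, α = Letter.arrow q) ∨
    (∀ i α, γ.letter i = some α → ∃ q, α = Letter.inv q)

/-- The set `c⁺(γ, δ)` of positive crossings from `γ` to `δ`. An element `(i, j, n)` is a pair of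
decompositions `γ = γ₁ q⁻ ω q' γ₂` and `δ = δ₁ r ω r'⁻ δ₂` with `q, q', r, r'` arrows, where `q⁻`
has index `i` in `γ`, `r` has index `j` in `δ`, and `ω` is a common subwalk with `n` letters.
If `n = 0`, then `ω` is a common stationary walk: a pair of arrows `x, y` with `xy ≠ 0`, such that
`q⁻` and `r` can be followed by `y`, and `q'` and `r'⁻` can be preceded by `x`. -/
def posCrossings (γ δ : Walk Q) : Set (ℤ × ℤ × ℕ) :=
  {c | ∃ q q' r r' : A,
    γ.letter c.1 = some (Letter.inv q) ∧
    γ.letter (c.1 + c.2.2 + 1) = some (Letter.arrow q') ∧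
    δ.letter c.2.1 = some (Letter.arrow r) ∧
    δ.letter (c.2.1 + c.2.2 + 1) = some (Letter.inv r') ∧
    (∀ k : ℕ, 1 ≤ k → k ≤ c.2.2 → γ.letter (c.1 + k) = δ.letter (c.2.1 + k)) ∧
    (c.2.2 = 0 → ∃ x y : A, Letter.Composable Q (Letter.arrow x) (Letter.arrow y) ∧
      Letter.Composable Q (Letter.inv q) (Letter.arrow y) ∧
      Letter.Composable Q (Letter.arrow x) (Letter.arrow q') ∧
      Letter.Composable Q (Letter.arrow r) (Letter.arrow y) ∧
      Letter.Composable Q (Letter.arrow x) (Letter.inv r'))}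

/-- Walks up to inversion (and translation of indices). -/
def stringSetoid (Q : BoundQuiver V A) : Setoid (Walk Q) :=
  ⟨SameString, sameString_equivalence⟩

end Walk

/-- (Non-stationary) strings. -/
def Str {V : Type u} {A : Type v} (Q : BoundQuiver V A) : Type v :=
  Quotient (Walk.stringSetoid Q)

/-- The string of a walk. -/
def Walk.str {V : Type u} {A : Type v} {Q : BoundQuiver V A} (γ : Walk Q) : Str Q :=
  Quotient.mk (Walk.stringSetoid Q) γ

namespace Str

variable {V : Type u} {A : Type v} {Q : BoundQuiver V A}

/-- An infinite string. -/
def IsInfinite (O : Set V) (σ : Str Q) : Prop := ∃ γ : Walk Q, γ.str = σ ∧ γ.IsInfinite O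

/-- A periodic string. -/
def IsPeriodic (σ : Str Q) : Prop := ∃ γ : Walk Q, γ.str = σ ∧ γ.IsPeriodic

/-- A null string. -/
def IsNull (σ : Str Q) : Prop := ∃ γ : Walk Q, γ.str = σ ∧ γ.IsNull

/-- `c⁺(σ, τ) ≠ ∅`: some walks underlying `σ` and `τ` have a positive crossing from the first to
the second. -/
def PosCrosses (σ τ : Str Q) : Prop :=
  ∃ γ δ : Walk Q, γ.str = σ ∧ δ.str = τ ∧ (Walk.posCrossings γ δ).Nonempty

end Str

section MaximalNonCrossing

variable {V : Type u} {A : Type v}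

/-- A non-crossing set of strings (in particular, no element crosses itself). -/
def IsNonCrossing {Q : BoundQuiver V A} (S : Set (Str Q)) : Prop :=
  ∀ σ ∈ S, ∀ τ ∈ S, ¬ σ.PosCrosses τ

/-- The type of maximal non-crossing sets of infinite strings of a blossoming `Q` whose set of old
vertices is `O`. -/
def MaxNonCrossing (Q : BoundQuiver V A) (O : Set V) : Type v :=
  {S : Set (Str Q) // Maximal (fun T => (∀ σ ∈ T, σ.IsInfinite O) ∧ IsNonCrossing T) S}

/-- The crossing order: `S ≤ T` if there is no positive crossing from an element of `S` to an
element of `T`. -/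
def MaxNonCrossing.CrossingLE {Q : BoundQuiver V A} {O : Set V} (S T : MaxNonCrossing Q O) : Prop :=
  ∀ σ ∈ S.1, ∀ τ ∈ T.1, ¬ σ.PosCrosses τ

/-- The set of non-null periodic strings in `S`. -/
def MaxNonCrossing.periodicPart {Q : BoundQuiver V A} {O : Set V} (S : MaxNonCrossing Q O) :
    Set (Str Q) :=
  {σ | σ ∈ S.1 ∧ σ.IsPeriodic ∧ ¬ σ.IsNull}

/-- A `B`-parametrised maximal non-crossing set `(S, λ)`, with `λ` a map from the set of non-null
periodic strings in `S` to the power set of `B`. -/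
structure ParamMaxNonCrossing (Q : BoundQuiver V A) (O : Set V) (B : Type b) where
  strings : MaxNonCrossing Q O
  param : strings.periodicPart → Set B

/-- The order on `B`-parametrised maximal non-crossing sets. -/
def ParamMaxNonCrossing.ParamLE {Q : BoundQuiver V A} {O : Set V} {B : Type b}
    (x y : ParamMaxNonCrossing Q O B) : Prop :=
  x.strings.CrossingLE y.strings ∧
    ∀ (σ : Str Q) (hx : σ ∈ x.strings.periodicPart) (hy : σ ∈ y.strings.periodicPart),
      x.param ⟨σ, hx⟩ ⊆ y.param ⟨σ, hy⟩

end MaximalNonCrossing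

end GentleStrings

/-!
For a set `U` of infinite strings let `U^⊥` be the set of infinite strings to which no element of
`U` has a positive crossing, and `^⊥U` the set of those without positive crossings to elements
of `U`. These two operations form a Galois connection, so the pairs `(T, F)` with `F = T^⊥` and
`T = ^⊥F` form a complete lattice. The theorem holds because `(T, F) ↦ T ∩ F` identifies this lattice
with the maximal non-crossing sets.

The point is a separation property (`exists_crosses_mem_inter`): if an infinite string `ρ` is not in
`T`, then `ρ` has a positive crossing to some element of `T ∩ F`, and dually. To find this
element, take a positive crossing from `ρ` to an element of `F` with shortest possible common part
`ω`, so that this element contains a piece `r ω r'⁻`. Among the walks of `F` containing this piece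
there is, by compactness (`exists_lex_extremal`), one that is lexicographically extremal in both
directions outwards from the piece, where inverse letters are preferred when reading outwards. If
this walk had a positive crossing to some `φ` in `F`, then the two smoothings of the crossing would
again belong to `F` (`CrossAt.of_smoothing`, `CrossAt.of_smoothing_swap`), and one of them would
contradict extremality, unless the crossing lies within `ω`. In that case `ρ` itself crosses `φ`
with a shorter common part. So the extremal walk belongs to `T ∩ F`.

Separation implies that `T ∩ F` is maximal non-crossing, that every maximal non-crossing set detects
all positive crossings (`MaxNonCrossing.exists_crosses`), which gives transitivity of the crossing
order, and that joins are computed from orthogonals (`MaxNonCrossing.exists_supremum`). A string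
that lies in both ends of a chain `S ≤ T ≤ U` also lies in `T`, and with this the order on
parametrised sets and its joins and meets follow formally.

Everything is stated for a sign `ε`, whose change exchanges arrows with their inverses and thereby
the roles of `T` and `F`, so that dual statements need no separate proof.
-/

namespace GentleStrings

/-! ### Letters of a gentle quiver -/

section Letters

variable {V : Type u} {A : Type v} {Q : BoundQuiver V A}

/-- The sign of a letter: `true` for an arrow, `false` for the inverse of an arrow. -/
def Letter.isArrow : Letter A → Bool
  | arrow _ => true
  | inv _ => false

theorem Letter.isArrow_rev (α : Letter A) : α.rev.isArrow = !α.isArrow := by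
  cases α <;> rfl

theorem Letter.eq_arrow {α : Letter A} (h : α.isArrow = true) : ∃ q, α = arrow q := by
  cases α with
  | arrow q => exact ⟨q, rfl⟩
  | inv q => simp [isArrow] at h

theorem Letter.eq_inv {α : Letter A} (h : α.isArrow = false) : ∃ q, α = inv q := by
  cases α with
  | arrow q => simp [isArrow] at h
  | inv q => exact ⟨q, rfl⟩

instance Letter.finite [Finite A] : Finite (Letter A) :=
  Finite.of_surjective (fun p : A ⊕ A => Sum.elim arrow inv p) (by
    rintro (q | q)
    · exact ⟨Sum.inl q, rfl⟩
    · exact ⟨Sum.inr q, rfl⟩)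

theorem Letter.Composable.rev {α β : Letter A} (h : Composable Q α β) :
    Composable Q β.rev α.rev := by
  cases α <;> cases β <;> first | exact h | exact ⟨h.1.symm, h.2.symm⟩

theorem eq_of_ne_of_encard_le_two {X : Type*} {s : Set X} (hs : s.encard ≤ 2) {a b c : X}
    (ha : a ∈ s) (hb : b ∈ s) (hc : c ∈ s) (hab : a ≠ b) (hac : a ≠ c) : b = c := by
  by_contra hbc
  have h3 : ({a, b, c} : Set X).encard = 3 := Set.encard_eq_three.2 ⟨a, b, c, hab, hac, hbc, rfl⟩
  have hsub : ({a, b, c} : Set X) ⊆ s := by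
    rintro x (rfl | rfl | rfl) <;> assumption
  have := (Set.encard_le_encard hsub).trans hs
  rw [h3] at this
  exact absurd this (by decide)

/-- In a gentle quiver, a letter is followed by at most one letter of each sign. -/
theorem BoundQuiver.IsGentle.composable_right_unique (hQ : Q.IsGentle) {α β β' : Letter A}
    (h : Letter.Composable Q α β) (h' : Letter.Composable Q α β')
    (hs : β.isArrow = β'.isArrow) : β = β' := by
  cases α with
  | arrow q =>
    cases β with
    | arrow r =>
      cases β' with
      | arrow r' => rw [hQ.right_nonzero q h h']
      | inv r' => simp [Letter.isArrow] at hs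
    | inv r =>
      cases β' with
      | arrow r' => simp [Letter.isArrow] at hs
      | inv r' =>
        rw [eq_of_ne_of_encard_le_two (hQ.in_le_two (Q.tgt q)) (a := q) (b := r) (c := r') rfl
          h.1.symm h'.1.symm h.2 h'.2]
  | inv q =>
    cases β with
    | arrow r =>
      cases β' with
      | arrow r' =>
        rw [eq_of_ne_of_encard_le_two (hQ.out_le_two (Q.src q)) (a := q) (b := r) (c := r') rfl
          h.1.symm h'.1.symm h.2 h'.2]
      | inv r' => simp [Letter.isArrow] at hs
    | inv r =>
      cases β' with
      | arrow r' => simp [Letter.isArrow] at hs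
      | inv r' => rw [hQ.left_nonzero q h h']

theorem BoundQuiver.IsGentle.composable_left_unique (hQ : Q.IsGentle) {α α' β : Letter A}
    (h : Letter.Composable Q α β) (h' : Letter.Composable Q α' β)
    (hs : α.isArrow = α'.isArrow) : α = α' := by
  have := hQ.composable_right_unique h.rev h'.rev (by simp [Letter.isArrow_rev, hs])
  rw [← α.rev_rev, this, α'.rev_rev]

end Letters

/-! ### Signed crossings of walks -/

section Crossings

variable {V : Type u} {A : Type v} {Q : BoundQuiver V A}

/-- A crossing of sign `ε` from the word `w` to the word `v`, whose indices are translated so that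
the common part `ω` has the same indices, strictly between `i` and `j`, in both words. For
`ε = true` the two words read `q⁻ ω q'` and `r ω r'⁻` between `i` and `j`; for `ε = false` all signs
are interchanged, so that the crossing is a positive one from `v` to `w`. The last condition, for
stationary `ω`, says that the two smoothed words `r q'` and `q⁻ r'⁻` are walks; it replaces the pair
of arrows `x, y` in `Walk.posCrossings`, and for non-stationary `ω` it holds automatically. -/
structure CrossAt (Q : BoundQuiver V A) (ε : Bool) (w v : ℤ → Option (Letter A)) (i j : ℤ) :
    Prop where
  lt : i < j
  agree : ∀ k, i < k → k < j → w k = v k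
  ends : ∃ α α' β β' : Letter A, w i = some α ∧ w j = some α' ∧ v i = some β ∧ v j = some β' ∧
    α.isArrow = !ε ∧ α'.isArrow = ε ∧ β.isArrow = ε ∧ β'.isArrow = !ε ∧
    (j = i + 1 → Letter.Composable Q β α' ∧ Letter.Composable Q α β')

namespace CrossAt

variable {ε : Bool} {w w' v v' : ℤ → Option (Letter A)} {i j : ℤ}

theorem swap (h : CrossAt Q ε w v i j) : CrossAt Q (!ε) v w i j := by
  obtain ⟨α, α', β, β', h1, h2, h3, h4, s1, s2, s3, s4, hc⟩ := h.ends
  exact ⟨h.lt, fun k hk hk' => (h.agree k hk hk').symm, β, β', α, α', h3, h4, h1, h2,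
    by simpa using s3, s4, s1, by simpa using s2, fun e => ⟨(hc e).2, (hc e).1⟩⟩

theorem congr (h : CrossAt Q ε w v i j) (hw : ∀ k, i ≤ k → k ≤ j → w' k = w k)
    (hv : ∀ k, i ≤ k → k ≤ j → v' k = v k) : CrossAt Q ε w' v' i j := by
  have hij := h.lt
  refine ⟨hij, fun k hk hk' => ?_, ?_⟩
  · rw [hw k hk.le hk'.le, hv k hk.le hk'.le, h.agree k hk hk']
  · rw [hw i le_rfl hij.le, hw j hij.le le_rfl, hv i le_rfl hij.le, hv j hij.le le_rfl]
    exact h.ends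

theorem shift (h : CrossAt Q ε w v i j) (n : ℤ) :
    CrossAt Q ε (fun k => w (k + n)) (fun k => v (k + n)) (i - n) (j - n) := by
  have hij := h.lt
  refine ⟨by omega, fun k hk hk' => h.agree _ (by omega) (by omega), ?_⟩
  obtain ⟨α, α', β, β', h1, h2, h3, h4, s1, s2, s3, s4, hc⟩ := h.ends
  refine ⟨α, α', β, β', ?_, ?_, ?_, ?_, s1, s2, s3, s4, fun e => hc (by omega)⟩ <;>
    simpa using by assumption

theorem rev (h : CrossAt Q ε w v i j) (n : ℤ) :
    CrossAt Q ε (fun k => (w (n - k)).map Letter.rev) (fun k => (v (n - k)).map Letter.rev)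
      (n - j) (n - i) := by
  have hij := h.lt
  refine ⟨by omega, fun k hk hk' => ?_, ?_⟩
  · simp only [h.agree (n - k) (by omega) (by omega)]
  obtain ⟨α, α', β, β', h1, h2, h3, h4, s1, s2, s3, s4, hc⟩ := h.ends
  refine ⟨α'.rev, α.rev, β'.rev, β.rev, by simp [h2], by simp [h1], by simp [h4], by simp [h3],
    by simp [Letter.isArrow_rev, s2], by simp [Letter.isArrow_rev, s1],
    by simp [Letter.isArrow_rev, s4], by simp [Letter.isArrow_rev, s3], fun e => ?_⟩
  have := hc (by omega)
  exact ⟨this.2.rev, this.1.rev⟩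

end CrossAt

/-- The walk with indices translated by `n`. -/
def Walk.shift (γ : Walk Q) (n : ℤ) : Walk Q where
  letter k := γ.letter (k + n)
  nonempty := by
    obtain ⟨i, hi⟩ := γ.nonempty
    exact ⟨i - n, by simpa using hi⟩
  interval := ⟨fun x hx y hy z hz =>
    γ.interval.out hx hy ⟨by linarith [hz.1], by linarith [hz.2]⟩⟩
  composable i α β h h' := γ.composable (i + n) α β h (by rw [← h']; congr 1; ring)

/-- The inverse walk, with indices reflected by `k ↦ n - k`. -/
def Walk.revAt (γ : Walk Q) (n : ℤ) : Walk Q where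
  letter k := (γ.letter (n - k)).map Letter.rev
  nonempty := by
    obtain ⟨i, hi⟩ := γ.nonempty
    exact ⟨n - i, by simpa using hi⟩
  interval := by
    refine ⟨fun x hx y hy z hz => ?_⟩
    have := γ.interval.out (x := n - y) (y := n - x) (by simpa using hy) (by simpa using hx)
      (show n - z ∈ _ from ⟨by linarith [hz.2], by linarith [hz.1]⟩)
    simpa using this
  composable i α β h h' := by
    obtain ⟨a, ha, rfl⟩ := Option.map_eq_some_iff.1 h
    obtain ⟨b, hb, rfl⟩ := Option.map_eq_some_iff.1 h'
    exact (γ.composable (n - (i + 1)) b a hb (by rw [← ha]; congr 1; ring)).rev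

theorem Walk.str_eq_str {γ δ : Walk Q} : γ.str = δ.str ↔ Walk.SameString γ δ :=
  Quotient.eq (r := Walk.stringSetoid Q)

theorem Walk.str_shift (γ : Walk Q) (n : ℤ) : (γ.shift n).str = γ.str :=
  (Walk.str_eq_str.2 (Or.inl ⟨n, fun _ => rfl⟩)).symm

theorem Walk.str_revAt (γ : Walk Q) (n : ℤ) : (γ.revAt n).str = γ.str :=
  (Walk.str_eq_str.2 (Or.inr ⟨n, fun _ => rfl⟩)).symm

/-- There is a crossing of sign `ε` from `σ` to `τ`: for `ε = true` a positive crossing from `σ` to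
`τ` (in a gentle quiver, see `Str.posCrosses_iff`), for `ε = false` one from `τ` to `σ`. -/
def Str.Crosses (ε : Bool) (σ τ : Str Q) : Prop :=
  ∃ γ δ : Walk Q, γ.str = σ ∧ δ.str = τ ∧ ∃ i j, CrossAt Q ε γ.letter δ.letter i j

theorem Str.Crosses.swap {ε : Bool} {σ τ : Str Q} (h : σ.Crosses ε τ) : τ.Crosses (!ε) σ := by
  obtain ⟨γ, δ, hγ, hδ, i, j, h⟩ := h
  exact ⟨δ, γ, hδ, hγ, i, j, h.swap⟩

/-- A crossing of strings is visible on any chosen walk underlying the first string, since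
crossings can be translated and inverted. -/
theorem Str.crosses_str_left {ε : Bool} {γ : Walk Q} {τ : Str Q} (h : γ.str.Crosses ε τ) :
    ∃ δ : Walk Q, δ.str = τ ∧ ∃ i j, CrossAt Q ε γ.letter δ.letter i j := by
  obtain ⟨γ', δ, hγ, rfl, i, j, h⟩ := h
  rcases Walk.str_eq_str.1 hγ with ⟨n, e⟩ | ⟨n, e⟩
  · refine ⟨δ.shift n, δ.str_shift n, i - n, j - n, ?_⟩
    rw [show γ.letter = fun k => γ'.letter (k + n) from funext e]
    exact h.shift n
  · refine ⟨δ.revAt n, δ.str_revAt n, n - j, n - i, ?_⟩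
    rw [show γ.letter = fun k => (γ'.letter (n - k)).map Letter.rev from funext e]
    exact h.rev n

theorem Str.crosses_str_right {ε : Bool} {σ : Str Q} {δ : Walk Q} (h : σ.Crosses ε δ.str) :
    ∃ γ : Walk Q, γ.str = σ ∧ ∃ i j, CrossAt Q ε γ.letter δ.letter i j := by
  obtain ⟨γ, hγ, i, j, h⟩ := crosses_str_left h.swap
  exact ⟨γ, hγ, i, j, by simpa using h.swap⟩

theorem Str.posCrosses_iff (hQ : Q.IsGentle) {σ τ : Str Q} :
    σ.PosCrosses τ ↔ σ.Crosses true τ := by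
  constructor
  · rintro ⟨γ, δ, hγ, hδ, ⟨i, j, n⟩, q, q', r, r', h1, h2, h3, h4, h5, h6⟩
    dsimp only at h1 h2 h3 h4 h5 h6
    refine ⟨γ, δ.shift (j - i), hγ, (δ.str_shift _).trans hδ, i, i + n + 1, by omega, ?_, ?_⟩
    · intro k hk hk'
      have := h5 (k - i).toNat (by omega) (by omega)
      rw [show i + ((k - i).toNat : ℤ) = k by omega,
        show j + ((k - i).toNat : ℤ) = k + (j - i) by omega] at this
      exact this
    · refine ⟨_, _, .arrow r, .inv r', h1, h2, ?_, ?_, rfl, rfl, rfl, rfl, fun e => ?_⟩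
      · simpa [Walk.shift] using h3
      · rw [← h4]
        exact congrArg δ.letter (by ring)
      · have hn : n = 0 := by omega
        subst hn
        obtain ⟨x, y, hxy, hqy, hxq, hry, hxr⟩ := h6 rfl
        have hqq := γ.composable i _ _ h1 (by simpa using h2)
        have hrr := δ.composable j _ _ h3 (by simpa using h4)
        -- `y` and `q'` both follow `q⁻`, so `y = q'`; hence `r q' ≠ 0`, and gentleness turns this
        -- into `r' q ≠ 0`.
        have hy := hQ.composable_right_unique hqy hqq rfl
        rw [hy] at hry
        refine ⟨hry, ?_⟩
        have htr : Q.tgt r' = Q.src q := (hrr.1.symm.trans hry.1).trans hqq.1.symm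
        refine ⟨htr, fun hrel => ?_⟩
        by_cases hr : (r, q) ∈ Q.rel
        · exact hrr.2 (hQ.left_zero q ⟨hrr.1.trans htr, hr⟩ ⟨htr, hrel⟩)
        · exact hqq.2 (hQ.right_nonzero r ⟨hrr.1.trans htr, hr⟩ hry)
  · rintro ⟨γ, δ, hγ, hδ, i, j, h⟩
    have hij := h.lt
    obtain ⟨α, α', β, β', h1, h2, h3, h4, s1, s2, s3, s4, hc⟩ := h.ends
    obtain ⟨q, rfl⟩ := Letter.eq_inv s1
    obtain ⟨q', rfl⟩ := Letter.eq_arrow s2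
    obtain ⟨r, rfl⟩ := Letter.eq_arrow s3
    obtain ⟨r', rfl⟩ := Letter.eq_inv s4
    have hj : i + ((j - i - 1).toNat : ℤ) + 1 = j := by omega
    refine ⟨γ, δ, hγ, hδ, (i, i, (j - i - 1).toNat), q, q', r, r', h1, ?_, h3, ?_, ?_, ?_⟩
    · dsimp only
      rw [hj, h2]
    · dsimp only
      rw [hj, h4]
    · intro k hk hk'
      exact h.agree _ (by dsimp only at hk'; omega) (by dsimp only at hk'; omega)
    · intro e
      dsimp only at e
      have e' : j = i + 1 := by omega
      subst e'
      have hc' := (hc rfl).1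
      exact ⟨r, q', hc', γ.composable i _ _ h1 h2, hc', hc', δ.composable i _ _ h3 h4⟩

end Crossings

/-! ### Infinite walks by local conditions -/

section Infinite

variable {V : Type u} {A : Type v} {Q : BoundQuiver V A} {O : Set V}

theorem Walk.letter_ne_none_of_mem_Icc (γ : Walk Q) {x y z : ℤ} (hx : γ.letter x ≠ none)
    (hz : γ.letter z ≠ none) (hxy : x ≤ y) (hyz : y ≤ z) : γ.letter y ≠ none :=
  γ.interval.out hx hz ⟨hxy, hyz⟩

/-- Right-infinity is a condition on pairs of consecutive letters, so it survives recombination of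
walks and passage to limits. -/
theorem Walk.rightInfinite_iff (γ : Walk Q) : γ.RightInfinite O ↔
    ∀ i α, γ.letter i = some α → α.tgt Q ∈ O → γ.letter (i + 1) ≠ none := by
  constructor
  · rintro (h | ⟨m, β, hm, hm', hO⟩) i α hi hα
    · obtain ⟨j, hj, hj'⟩ := h i
      exact γ.letter_ne_none_of_mem_Icc (by simp [hi]) hj' (by omega : i ≤ i + 1) (by omega)
    · intro hn
      rcases lt_trichotomy i m with hlt | rfl | hlt
      · exact γ.letter_ne_none_of_mem_Icc (x := i) (z := m) (by simp [hi]) (by simp [hm])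
          (by omega) (by omega) hn
      · rw [hi] at hm
        cases hm
        exact hO hα
      · exact γ.letter_ne_none_of_mem_Icc (x := m) (z := i) (by simp [hm]) (by simp [hi])
          (by omega) (by omega) hm'
  · intro h
    by_cases hub : ∀ i, ∃ j > i, γ.letter j ≠ none
    · exact Or.inl hub
    push Not at hub
    obtain ⟨b, hb⟩ := hub
    obtain ⟨m, hm, hmax⟩ := Int.exists_greatest_of_bdd (P := fun k => γ.letter k ≠ none)
      ⟨b, fun z hz => by
        by_contra hlt
        exact hz (hb z (by omega))⟩ γ.nonempty
    obtain ⟨α, hα⟩ := Option.ne_none_iff_exists'.1 hm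
    have hnone : γ.letter (m + 1) = none := by
      by_contra hne
      have := hmax _ hne
      omega
    exact Or.inr ⟨m, α, hα, hnone, fun hO => h m α hα hO hnone⟩

theorem Walk.leftInfinite_iff (γ : Walk Q) : γ.LeftInfinite O ↔
    ∀ i α, γ.letter i = some α → α.src Q ∈ O → γ.letter (i - 1) ≠ none := by
  constructor
  · rintro (h | ⟨m, β, hm, hm', hO⟩) i α hi hα
    · obtain ⟨j, hj, hj'⟩ := h i
      exact γ.letter_ne_none_of_mem_Icc hj' (by simp [hi]) (by omega) (by omega : i - 1 ≤ i)
    · intro hn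
      rcases lt_trichotomy i m with hlt | rfl | hlt
      · exact γ.letter_ne_none_of_mem_Icc (x := i) (z := m) (by simp [hi]) (by simp [hm])
          (by omega) (by omega) hm'
      · rw [hi] at hm
        cases hm
        exact hO hα
      · exact γ.letter_ne_none_of_mem_Icc (x := m) (z := i) (by simp [hm]) (by simp [hi])
          (by omega) (by omega) hn
  · intro h
    by_cases hub : ∀ i, ∃ j < i, γ.letter j ≠ none
    · exact Or.inl hub
    push Not at hub
    obtain ⟨b, hb⟩ := hub
    obtain ⟨m, hm, hmin⟩ := Int.exists_least_of_bdd (P := fun k => γ.letter k ≠ none)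
      ⟨b, fun z hz => by
        by_contra hlt
        exact hz (hb z (by omega))⟩ γ.nonempty
    obtain ⟨α, hα⟩ := Option.ne_none_iff_exists'.1 hm
    have hnone : γ.letter (m - 1) = none := by
      by_contra hne
      have := hmin _ hne
      omega
    exact Or.inr ⟨m, α, hα, hnone, fun hO => h m α hα hO hnone⟩

theorem Letter.src_rev (α : Letter A) : α.rev.src Q = α.tgt Q := by cases α <;> rfl

theorem Letter.tgt_rev (α : Letter A) : α.rev.tgt Q = α.src Q := by cases α <;> rfl

theorem Walk.IsInfinite.of_str_eq {γ δ : Walk Q} (h : γ.IsInfinite O) (e : γ.str = δ.str) :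
    δ.IsInfinite O := by
  obtain ⟨hl, hr⟩ := h
  rw [Walk.leftInfinite_iff] at hl
  rw [Walk.rightInfinite_iff] at hr
  rw [Walk.IsInfinite, Walk.leftInfinite_iff, Walk.rightInfinite_iff]
  rcases Walk.str_eq_str.1 e with ⟨n, e⟩ | ⟨n, e⟩ <;> simp only [e]
  · refine ⟨fun i α hi hα => ?_, fun i α hi hα => ?_⟩
    · rw [show i - 1 + n = i + n - 1 by ring]
      exact hl _ _ hi hα
    · rw [show i + 1 + n = i + n + 1 by ring]
      exact hr _ _ hi hα
  · refine ⟨fun i α hi hα => ?_, fun i α hi hα => ?_⟩ <;>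
      obtain ⟨a, ha, rfl⟩ := Option.map_eq_some_iff.1 hi <;>
      rw [Ne, Option.map_eq_none_iff]
    · rw [show n - (i - 1) = n - i + 1 by ring]
      exact hr _ _ ha (by rwa [Letter.src_rev] at hα)
    · rw [show n - (i + 1) = n - i - 1 by ring]
      exact hl _ _ ha (by rwa [Letter.tgt_rev] at hα)

theorem Str.isInfinite_str {γ : Walk Q} : γ.str.IsInfinite O ↔ γ.IsInfinite O :=
  ⟨fun ⟨_, e, h⟩ => h.of_str_eq e, fun h => ⟨γ, rfl, h⟩⟩

end Infinite

/-! ### Smoothing a crossing -/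

section Smoothing

variable {V : Type u} {A : Type v} {Q : BoundQuiver V A} {O : Set V} {ε : Bool}

/-- Smoothing a crossing: the walk that follows `γ` before the position `j` and `δ` from there on. -/
theorem CrossAt.exists_smoothing {γ δ : Walk Q} {i j : ℤ}
    (h : CrossAt Q ε γ.letter δ.letter i j) :
    ∃ η : Walk Q, (∀ k, k < j → η.letter k = γ.letter k) ∧
      (∀ k, j ≤ k → η.letter k = δ.letter k) ∧
      (γ.IsInfinite O → δ.IsInfinite O → η.IsInfinite O) := by
  have hij := h.lt
  obtain ⟨α, α', β, β', h1, h2, h3, h4, -, -, -, -, hc⟩ := h.ends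
  have hlast : γ.letter (j - 1) ≠ none :=
    γ.letter_ne_none_of_mem_Icc (x := i) (z := j) (by simp [h1]) (by simp [h2]) (by omega)
      (by omega)
  have hfirst : δ.letter j ≠ none := by simp [h4]
  let w : ℤ → Option (Letter A) := fun k => if k < j then γ.letter k else δ.letter k
  have hwl : ∀ k, k < j → w k = γ.letter k := fun k hk => if_pos hk
  have hwr : ∀ k, j ≤ k → w k = δ.letter k := fun k hk => if_neg (by omega)
  let η : Walk Q :=
    { letter := w
      nonempty := ⟨j, by rwa [hwr j le_rfl]⟩
      interval := by
        refine ⟨fun x hx z hz y hy => ?_⟩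
        obtain ⟨hxy, hyz⟩ := hy
        simp only [Set.mem_ofPred_eq] at hx hz ⊢
        by_cases hyj : y < j
        · rw [hwl y hyj]
          rw [hwl x (by omega)] at hx
          by_cases hzj : z < j
          · rw [hwl z hzj] at hz
            exact γ.letter_ne_none_of_mem_Icc hx hz hxy hyz
          · exact γ.letter_ne_none_of_mem_Icc hx hlast hxy (by omega)
        · rw [hwr y (by omega)]
          rw [hwr z (by omega)] at hz
          by_cases hxj : x < j
          · exact δ.letter_ne_none_of_mem_Icc hfirst hz (by omega) hyz
          · rw [hwr x (by omega)] at hx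
            exact δ.letter_ne_none_of_mem_Icc hx hz hxy hyz
      composable := by
        intro k a b ha hb
        rcases lt_trichotomy (k + 1) j with hk | hk | hk
        · rw [hwl _ (by omega)] at ha hb
          exact γ.composable k a b ha hb
        · rw [hwl _ (by omega)] at ha
          rw [hwr _ (by omega)] at hb
          by_cases hik : i = k
          · subst hik
            subst hk
            rw [h1] at ha
            rw [h4] at hb
            cases ha
            cases hb
            exact (hc rfl).2
          · rw [h.agree k (by omega) (by omega)] at ha
            exact δ.composable k a b ha hb
        · rw [hwr _ (by omega)] at ha hb
          exact δ.composable k a b ha hb }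
  refine ⟨η, hwl, hwr, fun hγ hδ => ⟨η.leftInfinite_iff.2 ?_, η.rightInfinite_iff.2 ?_⟩⟩
  · intro k a ha hO
    change w (k - 1) ≠ none
    change w k = some a at ha
    rcases lt_trichotomy k j with hk | hk | hk
    · rw [hwl _ (by omega)] at ha ⊢
      exact γ.leftInfinite_iff.1 hγ.1 k a ha hO
    · rw [hwl _ (by omega), hk]
      exact hlast
    · rw [hwr _ (by omega)] at ha ⊢
      exact δ.leftInfinite_iff.1 hδ.1 k a ha hO
  · intro k a ha hO
    change w (k + 1) ≠ none
    change w k = some a at ha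
    rcases lt_trichotomy (k + 1) j with hk | hk | hk
    · rw [hwl _ (by omega)] at ha ⊢
      exact γ.rightInfinite_iff.1 hγ.2 k a ha hO
    · rw [hwr _ (by omega), hk]
      exact hfirst
    · rw [hwr _ (by omega)] at ha ⊢
      exact δ.rightInfinite_iff.1 hδ.2 k a ha hO

/-- A crossing of sign `ε` from `σ` to the smoothing `w` of a crossing of sign `ε` from `γ` to `δ`
comes from a crossing of sign `ε` from `σ` to `γ` or to `δ`. Only a crossing whose common part
runs over the position `i` and reaches at least `j` is not seen directly in `γ` or `δ`. In that
case `σ` agrees with `γ` at `i`, and so separates from `δ` there with the right sign. -/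
theorem CrossAt.of_smoothing (hQ : Q.IsGentle) {γ δ σ : Walk Q} {i j a b : ℤ}
    {w : ℤ → Option (Letter A)} (h : CrossAt Q ε γ.letter δ.letter i j)
    (hl : ∀ k, k < j → w k = γ.letter k) (hr : ∀ k, j ≤ k → w k = δ.letter k)
    (hσ : CrossAt Q ε σ.letter w a b) :
    CrossAt Q ε σ.letter γ.letter a b ∨ ∃ a' b', CrossAt Q ε σ.letter δ.letter a' b' := by
  have hij := h.lt
  have hab := hσ.lt
  have hwδ : ∀ k, i < k → w k = δ.letter k := fun k hk => by
    by_cases hkj : k < j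
    · rw [hl k hkj, h.agree k hk hkj]
    · exact hr k (by omega)
  by_cases hbj : b < j
  · exact Or.inl (hσ.congr (fun _ _ _ => rfl) fun k _ hk => (hl k (by omega)).symm)
  refine Or.inr ?_
  by_cases hai : i < a
  · exact ⟨a, b, hσ.congr (fun _ _ _ => rfl) fun k hk _ => (hwδ k (by omega)).symm⟩
  obtain ⟨α, α', β, β', h1, h2, h3, h4, s1, s2, s3, s4, hc⟩ := h.ends
  obtain ⟨x, x', y, y', g1, g2, g3, g4, t1, t2, t3, t4, -⟩ := hσ.ends
  have hwi : w i = some α := by rw [hl i hij, h1]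
  have hne : a ≠ i := by
    rintro rfl
    rw [hwi] at g3
    cases g3
    simp [s1] at t3
  have hσi : σ.letter i = some α := by rw [hσ.agree i (by omega) (by omega), hwi]
  refine ⟨i, b, by omega, fun k hk hk' => ?_, α, x', β, y', hσi, g2, h3, ?_, s1, t2, s3, t4, ?_⟩
  · rw [hσ.agree k (by omega) hk', hwδ k hk]
  · rw [← hwδ b (by omega), g4]
  · intro e
    have hjb : j = b := by omega
    subst hjb
    subst e
    rw [hwδ _ (by omega), h4] at g4
    cases g4
    have := hQ.composable_right_unique (σ.composable i _ _ hσi g2) (γ.composable i _ _ h1 h2)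
      (t2.trans s2.symm)
    rw [this]
    exact hc rfl

/-- The analogue of `CrossAt.of_smoothing` for the other smoothing, which follows `δ` before `j` and
`γ` from there on. Here `σ` separates from `δ` at the position `j`. -/
theorem CrossAt.of_smoothing_swap (hQ : Q.IsGentle) {γ δ σ : Walk Q} {i j a b : ℤ}
    {w : ℤ → Option (Letter A)} (h : CrossAt Q ε γ.letter δ.letter i j)
    (hl : ∀ k, k < j → w k = δ.letter k) (hr : ∀ k, j ≤ k → w k = γ.letter k)
    (hσ : CrossAt Q ε σ.letter w a b) :
    CrossAt Q ε σ.letter γ.letter a b ∨ ∃ a' b', CrossAt Q ε σ.letter δ.letter a' b' := by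
  have hij := h.lt
  have hab := hσ.lt
  have hwγ : ∀ k, i < k → w k = γ.letter k := fun k hk => by
    by_cases hkj : k < j
    · rw [hl k hkj, h.agree k hk hkj]
    · exact hr k (by omega)
  by_cases hai : i < a
  · exact Or.inl (hσ.congr (fun _ _ _ => rfl) fun k hk _ => (hwγ k (by omega)).symm)
  refine Or.inr ?_
  by_cases hbj : b < j
  · exact ⟨a, b, hσ.congr (fun _ _ _ => rfl) fun k _ hk => (hl k (by omega)).symm⟩
  obtain ⟨α, α', β, β', h1, h2, h3, h4, s1, s2, s3, s4, hc⟩ := h.ends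
  obtain ⟨x, x', y, y', g1, g2, g3, g4, t1, t2, t3, t4, -⟩ := hσ.ends
  have hwj : w j = some α' := by rw [hr j le_rfl, h2]
  have hne : b ≠ j := by
    rintro rfl
    rw [hwj] at g4
    cases g4
    simp [s2] at t4
  have hσj : σ.letter j = some α' := by rw [hσ.agree j (by omega) (by omega), hwj]
  refine ⟨a, j, by omega, fun k hk hk' => ?_, x, α', y, β', g1, hσj, ?_, h4, t1, s2, t3, s4, ?_⟩
  · rw [hσ.agree k hk (by omega), hl k hk']
  · rw [← hl a (by omega), g3]
  · intro e
    have hai' : a = i := by omega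
    subst hai'
    subst e
    rw [hl _ (by omega), h3] at g3
    cases g3
    have := hQ.composable_left_unique (σ.composable a _ _ g1 hσj) (γ.composable a _ _ h1 h2)
      (t1.trans s1.symm)
    rw [this]
    exact hc rfl

end Smoothing

/-! ### Lexicographically extremal words -/

section Compactness

/-- A non-empty closed set of words over a finite alphabet (closedness is expressed by finite
windows) contains a word which, for the enumeration `e` of positions, is lexicographically extremal
with respect to the preferences `p`. -/
theorem exists_lex_extremal {ι X : Type*} [Finite X] {K : Set (ι → X)} (hne : K.Nonempty)
    (hK : ∀ w, (∀ s : Finset ι, ∃ φ ∈ K, ∀ k ∈ s, φ k = w k) → w ∈ K)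
    (e : ℕ → ι) (p : ι → X → Prop) :
    ∃ w ∈ K, ∀ n, ∀ φ ∈ K, (∀ m < n, φ (e m) = w (e m)) → p (e n) (φ (e n)) →
      p (e n) (w (e n)) := by
  classical
  let _ : TopologicalSpace X := ⊥
  have : DiscreteTopology X := ⟨rfl⟩
  have hclosed : IsClosed K := by
    refine isClosed_of_closure_subset fun w hw => hK w fun s => ?_
    have hopen : IsOpen {φ : ι → X | ∀ k ∈ s, φ k = w k} := by
      have : {φ : ι → X | ∀ k ∈ s, φ k = w k} = (s : Set ι).pi fun k => {w k} := by
        ext φ; simp [Set.mem_pi]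
      rw [this]
      exact isOpen_set_pi s.finite_toSet fun _ _ => isOpen_discrete _
    obtain ⟨φ, h1, h2⟩ := mem_closure_iff.1 hw _ hopen fun _ _ => rfl
    exact ⟨φ, h2, h1⟩
  -- Cut `K` down successively, fixing the letter at `e n` to a preferred one whenever some word
  -- remaining at that stage has one; the intersection is non-empty by compactness.
  have hstep : ∀ (n : ℕ) (C : {C : Set (ι → X) // C.Nonempty}), ∃ φ ∈ C.1,
      (∃ ψ ∈ C.1, p (e n) (ψ (e n))) → p (e n) (φ (e n)) := by
    rintro n ⟨C, ψ₀, hψ₀⟩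
    by_cases h : ∃ ψ ∈ C, p (e n) (ψ (e n))
    · obtain ⟨ψ, hψ, hp⟩ := h
      exact ⟨ψ, hψ, fun _ => hp⟩
    · exact ⟨ψ₀, hψ₀, fun h' => absurd h' h⟩
  choose c hc hcp using hstep
  let C : ℕ → {C : Set (ι → X) // C.Nonempty} := fun n => Nat.rec ⟨K, hne⟩
    (fun n D => ⟨{φ ∈ D.1 | φ (e n) = c n D (e n)}, c n D, hc n D, rfl⟩) n
  have hC : ∀ n, (C (n + 1)).1 = {φ ∈ (C n).1 | φ (e n) = c n (C n) (e n)} := fun _ => rfl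
  have hCclosed : ∀ n, IsClosed (C n).1 := by
    intro n
    induction n with
    | zero => exact hclosed
    | succ n ih =>
      rw [hC]
      exact ih.inter (isClosed_eq (continuous_apply (e n)) continuous_const)
  obtain ⟨w, hw⟩ := IsCompact.nonempty_iInter_of_sequence_nonempty_isCompact_isClosed
    (fun n => (C n).1) (fun n => by rw [hC]; exact Set.sep_subset _ _) (fun n => (C n).2)
    (hCclosed 0).isCompact hCclosed
  rw [Set.mem_iInter] at hw
  have hwe : ∀ n, w (e n) = c n (C n) (e n) := fun n => by
    have := hw (n + 1)
    rw [hC] at this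
    exact this.2
  refine ⟨w, hw 0, fun n φ hφ hagree hp => ?_⟩
  have hmem : ∀ m ≤ n, φ ∈ (C m).1 := by
    intro m hm
    induction m with
    | zero => exact hφ
    | succ m ih =>
      rw [hC]
      exact ⟨ih (by omega), by rw [hagree m (by omega), hwe]⟩
  rw [hwe]
  exact hcp n (C n) ⟨φ, hmem n le_rfl, hp⟩

/-- The extremal word is built outwards from the window from `i` to `j`, with preference `p` on the
right and `p'` on the left of it. -/
theorem exists_lex_extremal_int {X : Type*} [Finite X] {K : Set (ℤ → X)} (hne : K.Nonempty)
    (hK : ∀ w, (∀ s : Finset ℤ, ∃ φ ∈ K, ∀ k ∈ s, φ k = w k) → w ∈ K)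
    {i j : ℤ} (hij : i ≤ j) (p p' : X → Prop) :
    ∃ w ∈ K, (∀ n > j, ∀ φ ∈ K, (∀ m < n, φ m = w m) → p (φ n) → p (w n)) ∧
      ∀ n < i, ∀ φ ∈ K, (∀ m > n, φ m = w m) → p' (φ n) → p' (w n) := by
  -- Positions are enumerated as `j + 1, i - 1, j + 2, i - 2, …`.
  obtain ⟨w, hw, h⟩ := exists_lex_extremal hne hK
    (fun n : ℕ => if n % 2 = 0 then j + 1 + (n / 2 : ℕ) else i - 1 - (n / 2 : ℕ))
    (fun k => if j < k then p else p')
  refine ⟨w, hw, fun n hn φ hφ hagree hp => ?_, fun n hn φ hφ hagree hp => ?_⟩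
  · have := h (2 * (n - j - 1).toNat) φ hφ (fun m hm => hagree _ (by split_ifs <;> omega))
    simp only [show 2 * (n - j - 1).toNat % 2 = 0 by omega, if_true,
      show j + 1 + ((2 * (n - j - 1).toNat / 2 : ℕ) : ℤ) = n by omega, show j < n from hn] at this
    exact this hp
  · have := h (2 * (i - 1 - n).toNat + 1) φ hφ
      (fun m hm => hagree _ (by split_ifs <;> omega))
    simp only [show ¬ (2 * (i - 1 - n).toNat + 1) % 2 = 0 by omega, if_false,
      show i - 1 - (((2 * (i - 1 - n).toNat + 1) / 2 : ℕ) : ℤ) = n by omega,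
      show ¬ j < n by omega] at this
    exact this hp

end Compactness

/-! ### Separation of strings by orthogonal pairs -/

section Separation

variable {V : Type u} {A : Type v} {Q : BoundQuiver V A} {O : Set V}

/-- The infinite strings to which no element of `T` has a crossing of sign `ε`. For `ε = false`
these are the infinite strings without positive crossings to elements of `T`, so that the passage to
the left orthogonal is covered as well. -/
def rightOrthogonal (O : Set V) (ε : Bool) (T : Set (Str Q)) : Set (Str Q) :=
  {τ | τ.IsInfinite O ∧ ∀ σ ∈ T, ¬ σ.Crosses ε τ}

theorem str_mem_rightOrthogonal {ε : Bool} {T : Set (Str Q)} {δ : Walk Q} :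
    δ.str ∈ rightOrthogonal O ε T ↔ δ.IsInfinite O ∧
      ∀ γ : Walk Q, γ.str ∈ T → ∀ i j, ¬ CrossAt Q ε γ.letter δ.letter i j := by
  refine and_congr Str.isInfinite_str ⟨fun h γ hγ i j hc => ?_, fun h σ hσ hc => ?_⟩
  · exact h _ hγ ⟨γ, δ, rfl, rfl, i, j, hc⟩
  · obtain ⟨γ, rfl, i, j, hc⟩ := Str.crosses_str_right hc
    exact h γ hσ i j hc

/-- The walks with string in an orthogonal set form a closed set of words. -/
theorem exists_limit_walk {ε : Bool} {T : Set (Str Q)} {w : ℤ → Option (Letter A)}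
    (hne : ∃ i, w i ≠ none)
    (hw : ∀ s : Finset ℤ, ∃ δ : Walk Q, δ.str ∈ rightOrthogonal O ε T ∧
      ∀ k ∈ s, δ.letter k = w k) :
    ∃ δ : Walk Q, δ.letter = w ∧ δ.str ∈ rightOrthogonal O ε T := by
  let η : Walk Q :=
    { letter := w
      nonempty := hne
      interval := by
        refine ⟨fun x hx z hz y hy => ?_⟩
        obtain ⟨δ, -, h⟩ := hw {x, y, z}
        rw [Set.mem_ofPred_eq, ← h x (by simp)] at hx
        rw [Set.mem_ofPred_eq, ← h z (by simp)] at hz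
        rw [Set.mem_ofPred_eq, ← h y (by simp)]
        exact δ.letter_ne_none_of_mem_Icc hx hz hy.1 hy.2
      composable := by
        intro i α β hα hβ
        obtain ⟨δ, -, h⟩ := hw {i, i + 1}
        rw [← h i (by simp)] at hα
        rw [← h (i + 1) (by simp)] at hβ
        exact δ.composable i α β hα hβ }
  refine ⟨η, rfl, str_mem_rightOrthogonal.2 ⟨⟨η.leftInfinite_iff.2 ?_, η.rightInfinite_iff.2 ?_⟩,
    fun γ hγ i j hc => ?_⟩⟩
  · intro i α hα hO
    obtain ⟨δ, hδ, h⟩ := hw {i, i - 1}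
    change w (i - 1) ≠ none
    rw [← h (i - 1) (by simp)]
    exact δ.leftInfinite_iff.1 (str_mem_rightOrthogonal.1 hδ).1.1 i α
      ((h i (by simp)).trans hα) hO
  · intro i α hα hO
    obtain ⟨δ, hδ, h⟩ := hw {i, i + 1}
    change w (i + 1) ≠ none
    rw [← h (i + 1) (by simp)]
    exact δ.rightInfinite_iff.1 (str_mem_rightOrthogonal.1 hδ).1.2 i α
      ((h i (by simp)).trans hα) hO
  · obtain ⟨δ, hδ, h⟩ := hw (Finset.Icc i j)
    exact (str_mem_rightOrthogonal.1 hδ).2 γ hγ i j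
      (hc.congr (fun _ _ _ => rfl) fun k hk hk' => h k (Finset.mem_Icc.2 ⟨hk, hk'⟩))

/-- Let `T` and `F` be orthogonals of each other. An infinite string `ρ` outside `T` crosses some
element of `T ∩ F`. -/
theorem exists_crosses_mem_inter (hQ : Q.IsGentle) {ε : Bool} {T F : Set (Str Q)}
    (hF : F = rightOrthogonal O ε T) (hT : T = rightOrthogonal O (!ε) F)
    {ρ : Str Q} (hρ : ρ.IsInfinite O) (hρT : ρ ∉ T) :
    ∃ τ ∈ T ∩ F, ρ.Crosses ε τ := by
  classical
  obtain ⟨γ, rfl, hγ⟩ := hρ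
  have hnot : ∀ δ : Walk Q, δ.IsInfinite O → δ.str ∉ T →
      ∃ φ : Walk Q, φ.str ∈ F ∧ ∃ a b, CrossAt Q ε δ.letter φ.letter a b := by
    intro δ hδ hδT
    rw [hT, str_mem_rightOrthogonal] at hδT
    push Not at hδT
    obtain ⟨φ, hφ, a, b, hc⟩ := hδT hδ
    exact ⟨φ, hφ, a, b, by simpa using hc.swap⟩
  -- Among the crossings from `γ` to elements of `F`, fix one with shortest common part. `K` is the
  -- set of all walks of `F` that contain the same piece of `δ₀`, and `δ` is an element of `K`
  -- that is extremal outwards from this piece: to the right it prefers letters of sign `!ε`, to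
  -- the left letters of sign `ε`.
  have hex : ∃ n : ℕ, ∃ φ : Walk Q, φ.str ∈ F ∧ ∃ a b, (b - a).toNat = n ∧
      CrossAt Q ε γ.letter φ.letter a b := by
    obtain ⟨φ, hφ, a, b, hc⟩ := hnot γ hγ hρT
    exact ⟨_, φ, hφ, a, b, rfl, hc⟩
  obtain ⟨δ₀, hδ₀, i, j, hn, hc₀⟩ := Nat.find_spec hex
  have hmin : ∀ φ : Walk Q, φ.str ∈ F → ∀ a b, CrossAt Q ε γ.letter φ.letter a b →
      (j - i).toNat ≤ (b - a).toNat := fun φ hφ a b hc => by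
    rw [hn]
    exact Nat.find_min' hex ⟨φ, hφ, a, b, rfl, hc⟩
  have hij := hc₀.lt
  obtain ⟨α, α', β, β', h1, h2, h3, h4, s1, s2, s3, s4, -⟩ := hc₀.ends
  let K : Set (ℤ → Option (Letter A)) :=
    {w | (∃ δ : Walk Q, δ.letter = w ∧ δ.str ∈ F) ∧ ∀ k, i ≤ k → k ≤ j → w k = δ₀.letter k}
  have := hQ.finite_arrows
  obtain ⟨w, ⟨⟨δ, rfl, hδF⟩, hδ⟩, hright, hleft⟩ := exists_lex_extremal_int (K := K)
    ⟨δ₀.letter, ⟨δ₀, rfl, hδ₀⟩, fun _ _ _ => rfl⟩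
    (fun w hw => by
      have hcore : ∀ k, i ≤ k → k ≤ j → w k = δ₀.letter k := fun k hk hk' => by
        obtain ⟨φ, hφ, h⟩ := hw {k}
        rw [← h k (by simp), hφ.2 k hk hk']
      refine ⟨?_, hcore⟩
      rw [hF]
      refine exists_limit_walk ⟨i, by rw [hcore i le_rfl hij.le, h3]; simp⟩ fun s => ?_
      obtain ⟨_, ⟨⟨φ, rfl, hφ⟩, -⟩, h⟩ := hw s
      exact ⟨φ, hF ▸ hφ, h⟩)
    hij.le (fun x => ∃ α, x = some α ∧ α.isArrow = !ε) (fun x => ∃ α, x = some α ∧ α.isArrow = ε)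
  have hcross : CrossAt Q ε γ.letter δ.letter i j := hc₀.congr (fun _ _ _ => rfl) hδ
  refine ⟨δ.str, ⟨?_, hδF⟩, γ, δ, rfl, rfl, i, j, hcross⟩
  by_contra hδT
  have hδF' := hδF
  rw [hF, str_mem_rightOrthogonal] at hδF'
  obtain ⟨φ, hφ, a, b, hc⟩ := hnot δ hδF'.1 hδT
  have hφ' := hφ
  rw [hF, str_mem_rightOrthogonal] at hφ'
  have hab := hc.lt
  obtain ⟨x, x', y, y', g1, g2, g3, g4, t1, t2, t3, t4, -⟩ := hc.ends
  -- If the crossing from `δ` to `φ` ends to the right of the piece, a smoothing contradicts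
  -- extremality on the right.
  by_cases hbj : j < b
  · obtain ⟨η, hl, hr, hinf⟩ := hc.exists_smoothing (O := O)
    have hη : η.str ∈ F := by
      rw [hF, str_mem_rightOrthogonal]
      refine ⟨hinf hδF'.1 hφ'.1, fun σ hσ k l h => ?_⟩
      rcases hc.of_smoothing hQ hl hr h with h | ⟨k, l, h⟩
      · exact hδF'.2 σ hσ _ _ h
      · exact hφ'.2 σ hσ _ _ h
    obtain ⟨z, hz, hz'⟩ := hright b hbj η.letter
      ⟨⟨η, rfl, hη⟩, fun k hk hk' => by rw [hl k (by omega), hδ k hk hk']⟩ hl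
      ⟨y', by rw [hr b le_rfl, g4], t4⟩
    rw [g2] at hz
    cases hz
    simp [t2] at hz'
  -- If it starts to the left of the piece, the other smoothing contradicts extremality on the left.
  by_cases hai : a < i
  · obtain ⟨η, hl, hr, hinf⟩ := hc.swap.exists_smoothing (O := O)
    have hη : η.str ∈ F := by
      rw [hF, str_mem_rightOrthogonal]
      refine ⟨hinf hφ'.1 hδF'.1, fun σ hσ k l h => ?_⟩
      rcases hc.of_smoothing_swap hQ hl hr h with h | ⟨k, l, h⟩
      · exact hδF'.2 σ hσ _ _ h
      · exact hφ'.2 σ hσ _ _ h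
    have hagree : ∀ k > a, η.letter k = δ.letter k := fun k hk => by
      by_cases hkb : k < b
      · rw [hl k hkb, hc.agree k hk hkb]
      · exact hr k (by omega)
    obtain ⟨z, hz, hz'⟩ := hleft a hai η.letter
      ⟨⟨η, rfl, hη⟩, fun k hk hk' => by rw [hagree k (by omega), hδ k hk hk']⟩ hagree
      ⟨y, by rw [hl a hab, g3], t3⟩
    rw [g1] at hz
    cases hz
    simp [t1] at hz'
  -- Otherwise the signs force it into the interior of the piece, where `γ` and `δ` agree, so that
  -- `γ` has a shorter crossing to `φ`.
  have ha : a ≠ i := by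
    rintro rfl
    rw [hδ a le_rfl hij.le, h3] at g1
    cases g1
    simp [s3] at t1
  have hb : b ≠ j := by
    rintro rfl
    rw [hδ b hij.le le_rfl, h4] at g2
    cases g2
    simp [s4] at t2
  have := hmin φ hφ a b
    (hc.congr (fun k hk hk' => hcross.agree k (by omega) (by omega)) fun _ _ _ => rfl)
  omega

end Separation

/-! ### The lattice of maximal non-crossing sets -/

section Order

variable {V : Type u} {A : Type v} {Q : BoundQuiver V A} {O : Set V}

/-- If `T` and `F` are orthogonals of each other, then `T ∩ F` is a maximal non-crossing set. -/
theorem exists_maxNonCrossing_inter (hQ : Q.IsGentle) {T F : Set (Str Q)}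
    (hF : F = rightOrthogonal O true T) (hT : T = rightOrthogonal O false F) :
    ∃ S : MaxNonCrossing Q O, S.1 = T ∩ F := by
  have hTinf : ∀ σ ∈ T, σ.IsInfinite O := fun σ hσ => by rw [hT] at hσ; exact hσ.1
  have hcross : ∀ σ ∈ T, ∀ τ ∈ F, ¬ σ.PosCrosses τ := fun σ hσ τ hτ h => by
    rw [hF] at hτ
    exact hτ.2 σ hσ ((Str.posCrosses_iff hQ).1 h)
  refine ⟨⟨T ∩ F, ⟨fun σ hσ => hTinf σ hσ.1, fun σ hσ τ hτ => hcross σ hσ.1 τ hτ.2⟩, ?_⟩, rfl⟩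
  rintro S ⟨hSinf, hS⟩ hle ρ hρ
  by_contra hnot
  by_cases hρT : ρ ∈ T
  · have hρF : ρ ∉ F := fun h => hnot ⟨hρT, h⟩
    obtain ⟨τ, hτ, hc⟩ := exists_crosses_mem_inter hQ (ε := false) hT hF (hSinf ρ hρ) hρF
    exact hS τ (hle ⟨hτ.2, hτ.1⟩) ρ hρ ((Str.posCrosses_iff hQ).2 hc.swap)
  · obtain ⟨τ, hτ, hc⟩ := exists_crosses_mem_inter hQ (ε := true) hF hT (hSinf ρ hρ) hρT
    exact hS ρ hρ τ (hle hτ) ((Str.posCrosses_iff hQ).2 hc)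

theorem MaxNonCrossing.mem_of_forall (S : MaxNonCrossing Q O) {ρ : Str Q}
    (hinf : ρ.IsInfinite O) (hself : ¬ ρ.PosCrosses ρ) (h : ∀ σ ∈ S.1, ¬ σ.PosCrosses ρ)
    (h' : ∀ σ ∈ S.1, ¬ ρ.PosCrosses σ) : ρ ∈ S.1 := by
  refine S.2.le_of_ge (y := insert ρ S.1) ⟨?_, ?_⟩ (Set.subset_insert _ _) (Set.mem_insert _ _)
  · rintro σ (rfl | hσ)
    · exact hinf
    · exact S.2.prop.1 σ hσ
  · rintro σ (rfl | hσ) τ (rfl | hτ)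
    · exact hself
    · exact h' τ hτ
    · exact h σ hσ
    · exact S.2.prop.2 σ hσ τ hτ

/-- The Galois connection identity: three successive orthogonals reduce to one. -/
theorem rightOrthogonal_closed {ε : Bool} (U : Set (Str Q)) (hU : ∀ σ ∈ U, σ.IsInfinite O) :
    rightOrthogonal O ε U =
      rightOrthogonal O ε (rightOrthogonal O (!ε) (rightOrthogonal O ε U)) := by
  ext τ
  refine ⟨fun h => ⟨h.1, fun σ hσ hc => hσ.2 τ h hc.swap⟩, fun h => ⟨h.1, fun σ hσ hc => ?_⟩⟩
  exact h.2 σ ⟨hU σ hσ, fun τ' hτ' hc' => hτ'.2 σ hσ (by simpa using hc'.swap)⟩ hc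

/-- A maximal non-crossing set detects every positive crossing between infinite strings. This is
transitivity of the crossing order in disguise. -/
theorem MaxNonCrossing.exists_crosses (hQ : Q.IsGentle) (S : MaxNonCrossing Q O) {σ τ : Str Q}
    (hσ : σ.IsInfinite O) (hτ : τ.IsInfinite O) (h : σ.PosCrosses τ) :
    ∃ ρ ∈ S.1, σ.PosCrosses ρ ∨ ρ.PosCrosses τ := by
  set F := rightOrthogonal O true S.1 with hFdef
  set T := rightOrthogonal O false F with hT
  have hF : F = rightOrthogonal O true T := rightOrthogonal_closed _ S.2.prop.1
  have hTF : T ∩ F ⊆ S.1 := by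
    obtain ⟨S', hS'⟩ := exists_maxNonCrossing_inter hQ hF hT
    rw [← hS']
    refine S.2.le_of_ge S'.2.prop ?_
    rw [hS']
    intro ρ hρ
    have hinf := S.2.prop.1 ρ hρ
    exact ⟨⟨hinf, fun τ hτ hc => hτ.2 ρ hρ hc.swap⟩, hinf, fun τ hτ hc =>
      S.2.prop.2 τ hτ ρ hρ ((Str.posCrosses_iff hQ).2 hc)⟩
  by_cases hσT : σ ∈ T
  · have hτF : τ ∉ F := fun hτF => by
      rw [hF] at hτF
      exact hτF.2 σ hσT ((Str.posCrosses_iff hQ).1 h)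
    obtain ⟨ρ, hρ, hc⟩ := exists_crosses_mem_inter hQ (ε := false) hT hF hτ hτF
    exact ⟨ρ, hTF ⟨hρ.2, hρ.1⟩, Or.inr ((Str.posCrosses_iff hQ).2 hc.swap)⟩
  · obtain ⟨ρ, hρ, hc⟩ := exists_crosses_mem_inter hQ (ε := true) hF hT hσ hσT
    exact ⟨ρ, hTF hρ, Or.inl ((Str.posCrosses_iff hQ).2 hc)⟩

theorem MaxNonCrossing.CrossingLE.trans (hQ : Q.IsGentle) {S T U : MaxNonCrossing Q O}
    (h : S.CrossingLE T) (h' : T.CrossingLE U) : S.CrossingLE U := by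
  intro σ hσ τ hτ hc
  obtain ⟨ρ, hρ, hc | hc⟩ := T.exists_crosses hQ (S.2.prop.1 σ hσ) (U.2.prop.1 τ hτ) hc
  · exact h σ hσ ρ hρ hc
  · exact h' ρ hρ τ hτ hc

/-- Maximal non-crossing sets are convex along chains: a string in both ends lies in the middle. -/
theorem MaxNonCrossing.inter_subset {S T U : MaxNonCrossing Q O} (h : S.CrossingLE T)
    (h' : T.CrossingLE U) : S.1 ∩ U.1 ⊆ T.1 := fun ρ hρ =>
  T.mem_of_forall (S.2.prop.1 ρ hρ.1) (S.2.prop.2 ρ hρ.1 ρ hρ.1)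
    (fun σ hσ => h' σ hσ ρ hρ.2) fun σ hσ => h ρ hρ.1 σ hσ

theorem MaxNonCrossing.CrossingLE.antisymm {S T : MaxNonCrossing Q O} (h : S.CrossingLE T)
    (h' : T.CrossingLE S) : S = T :=
  Subtype.ext (Set.Subset.antisymm (fun _ hρ => inter_subset h h' ⟨hρ, hρ⟩)
    fun _ hρ => inter_subset h' h ⟨hρ, hρ⟩)

/-- The crossing order as a partial order. -/
@[reducible]
def crossingOrder (hQ : Q.IsGentle) (O : Set V) : PartialOrder (MaxNonCrossing Q O) where
  le S T := S.CrossingLE T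
  le_refl S := S.2.prop.2
  le_trans _ _ _ h h' := h.trans hQ h'
  le_antisymm _ _ h h' := h.antisymm h'

/-- The join of a family is `T ∩ F`, where `F` is the right orthogonal of its union and `T` is the
left orthogonal of `F`. -/
theorem MaxNonCrossing.exists_supremum (hQ : Q.IsGentle) (𝒮 : Set (MaxNonCrossing Q O)) :
    ∃ S : MaxNonCrossing Q O, (∀ T ∈ 𝒮, T.CrossingLE S) ∧
      ∀ S' : MaxNonCrossing Q O, (∀ T ∈ 𝒮, T.CrossingLE S') → S.CrossingLE S' := by
  set U : Set (Str Q) := ⋃ T ∈ 𝒮, T.1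
  have hU : ∀ σ ∈ U, σ.IsInfinite O := fun σ hσ => by
    obtain ⟨T, -, hσT⟩ := Set.mem_iUnion₂.1 hσ
    exact T.2.prop.1 σ hσT
  obtain ⟨S, hS⟩ := exists_maxNonCrossing_inter hQ (rightOrthogonal_closed (ε := true) U hU) rfl
  refine ⟨S, fun T hT σ hσ τ hτ hc => ?_, fun S' hS' σ hσ τ hτ hc => ?_⟩
  · rw [hS] at hτ
    exact hτ.2.2 σ (Set.mem_iUnion₂.2 ⟨T, hT, hσ⟩) ((Str.posCrosses_iff hQ).1 hc)
  · rw [hS] at hσ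
    refine hσ.1.2 τ ⟨S'.2.prop.1 τ hτ, fun ρ hρ hc' => ?_⟩ ((Str.posCrosses_iff hQ).1 hc).swap
    obtain ⟨T, hT, hρT⟩ := Set.mem_iUnion₂.1 hρ
    exact hS' T hT ρ hρT τ hτ ((Str.posCrosses_iff hQ).2 hc')

/-- The complete lattice of maximal non-crossing sets. -/
@[reducible]
noncomputable def crossingLattice (hQ : Q.IsGentle) (O : Set V) :
    CompleteLattice (MaxNonCrossing Q O) :=
  letI := crossingOrder hQ O
  letI : SupSet (MaxNonCrossing Q O) := ⟨fun 𝒮 => (MaxNonCrossing.exists_supremum hQ 𝒮).choose⟩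
  completeLatticeOfSup _ fun 𝒮 =>
    ⟨fun T hT => (MaxNonCrossing.exists_supremum hQ 𝒮).choose_spec.1 T hT,
      fun S hS => (MaxNonCrossing.exists_supremum hQ 𝒮).choose_spec.2 S fun _ hT => hS hT⟩

end Order

/-! ### The lattice of parametrised maximal non-crossing sets -/

section Parametrised

variable {V : Type u} {A : Type v} {Q : BoundQuiver V A} {O : Set V} {B : Type b}

namespace ParamMaxNonCrossing

theorem ParamLE.trans (hQ : Q.IsGentle) {x y z : ParamMaxNonCrossing Q O B}
    (h : x.ParamLE y) (h' : y.ParamLE z) : x.ParamLE z :=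
  ⟨h.1.trans hQ h'.1, fun σ hx hz =>
    have hy : σ ∈ y.strings.periodicPart :=
      ⟨MaxNonCrossing.inter_subset h.1 h'.1 ⟨hx.1, hz.1⟩, hx.2⟩
    (h.2 σ hx hy).trans (h'.2 σ hy hz)⟩

theorem ParamLE.antisymm {x y : ParamMaxNonCrossing Q O B}
    (h : x.ParamLE y) (h' : y.ParamLE x) : x = y := by
  obtain ⟨S, p⟩ := x
  obtain ⟨T, q⟩ := y
  obtain rfl : S = T := h.1.antisymm h'.1
  congr
  funext σ
  exact Set.Subset.antisymm (h.2 σ.1 σ.2 σ.2) (h'.2 σ.1 σ.2 σ.2)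

/-- The order on parametrised maximal non-crossing sets as a partial order. -/
@[reducible]
def order (hQ : Q.IsGentle) (O : Set V) (B : Type b) :
    PartialOrder (ParamMaxNonCrossing Q O B) where
  le x y := x.ParamLE y
  le_refl x := ⟨x.strings.2.prop.2, fun _ _ _ => subset_rfl⟩
  le_trans _ _ _ h h' := h.trans hQ h'
  le_antisymm _ _ h h' := h.antisymm h'

/-- The parametrisation of `S` that assigns to `σ` the union of its values in those members of the
family that contain `σ`. -/
def withUnion {ι : Type*} (x : ι → ParamMaxNonCrossing Q O B) (S : MaxNonCrossing Q O) :
    ParamMaxNonCrossing Q O B :=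
  ⟨S, fun σ => ⋃ (i : ι) (hi : σ.1 ∈ (x i).strings.periodicPart), (x i).param ⟨σ.1, hi⟩⟩

/-- The parametrisation of `S` that assigns to `σ` the intersection of its values in those members of
the family that contain `σ`; the empty intersection is all of `B`. -/
def withInter {ι : Type*} (x : ι → ParamMaxNonCrossing Q O B) (S : MaxNonCrossing Q O) :
    ParamMaxNonCrossing Q O B :=
  ⟨S, fun σ => ⋂ (i : ι) (hi : σ.1 ∈ (x i).strings.periodicPart), (x i).param ⟨σ.1, hi⟩⟩

theorem isLUB_withUnion (hQ : Q.IsGentle) {ι : Type*} (x : ι → ParamMaxNonCrossing Q O B)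
    {S : MaxNonCrossing Q O}
    (hS : letI := crossingOrder hQ O; IsLUB (Set.range fun i => (x i).strings) S) :
    letI := order hQ O B; IsLUB (Set.range x) (withUnion x S) := by
  let _ := order hQ O B
  constructor
  · rintro _ ⟨i, rfl⟩
    exact ⟨hS.1 ⟨i, rfl⟩, fun σ hx hz b hb => Set.mem_iUnion₂.2 ⟨i, hx, hb⟩⟩
  · intro z hz
    refine ⟨hS.2 ?_, fun σ hx hz' b hb => ?_⟩
    · rintro _ ⟨i, rfl⟩
      exact (hz ⟨i, rfl⟩ : (x i).ParamLE z).1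
    · obtain ⟨i, hi, hb⟩ := Set.mem_iUnion₂.1 hb
      exact (hz ⟨i, rfl⟩ : (x i).ParamLE z).2 σ hi hz' hb

theorem isGLB_withInter (hQ : Q.IsGentle) {ι : Type*} (x : ι → ParamMaxNonCrossing Q O B)
    {S : MaxNonCrossing Q O}
    (hS : letI := crossingOrder hQ O; IsGLB (Set.range fun i => (x i).strings) S) :
    letI := order hQ O B; IsGLB (Set.range x) (withInter x S) := by
  let _ := order hQ O B
  constructor
  · rintro _ ⟨i, rfl⟩
    exact ⟨hS.1 ⟨i, rfl⟩, fun σ hx hz b hb => Set.mem_iInter₂.1 hb i hz⟩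
  · intro z hz
    refine ⟨hS.2 ?_, fun σ hx hz' b hb => Set.mem_iInter₂.2 fun i hi => ?_⟩
    · rintro _ ⟨i, rfl⟩
      exact (hz ⟨i, rfl⟩ : z.ParamLE (x i)).1
    · exact (hz ⟨i, rfl⟩ : z.ParamLE (x i)).2 σ hx hi hb

/-- The complete lattice of parametrised maximal non-crossing sets. -/
@[reducible]
noncomputable def lattice (hQ : Q.IsGentle) (O : Set V) (B : Type b) :
    CompleteLattice (ParamMaxNonCrossing Q O B) :=
  letI := order hQ O B
  letI : SupSet (ParamMaxNonCrossing Q O B) := ⟨fun s =>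
    withUnion (Subtype.val : s → _)
      (letI := crossingLattice hQ O; ⨆ x : s, x.1.strings)⟩
  completeLatticeOfSup _ fun s => by
    have := isLUB_withUnion hQ (Subtype.val : s → ParamMaxNonCrossing Q O B)
      (letI := crossingLattice hQ O; isLUB_iSup (f := fun x : s => x.1.strings))
    rwa [Subtype.range_coe] at this

end ParamMaxNonCrossing

end Parametrised

end GentleStrings

theorem mainTheorem3 {V : Type u} {A : Type v} {V' : Type u'} {A' : Type v'}
    (Q : GentleStrings.BoundQuiver V A) (hQ : Q.IsGentle)
    (Q' : GentleStrings.BoundQuiver V' A') (f : V → V') (g : A → A')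
    (hQ' : GentleStrings.IsBlossoming Q Q' f g) (B : Type b) :
    ∃ (L₀ : CompleteLattice (GentleStrings.MaxNonCrossing Q' (Set.range f)))
      (L : CompleteLattice (GentleStrings.ParamMaxNonCrossing Q' (Set.range f) B)),
      (∀ S T, L₀.le S T ↔ S.CrossingLE T) ∧
      (∀ x y, L.le x y ↔ x.ParamLE y) ∧
      ∀ (ι : Type w) (x : ι → GentleStrings.ParamMaxNonCrossing Q' (Set.range f) B),
        ((⨆ i, x i).strings = ⨆ i, (x i).strings ∧
          ∀ σ (hσ : σ ∈ (⨆ i, x i).strings.periodicPart),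
            (⨆ i, x i).param ⟨σ, hσ⟩ =
              ⋃ (i : ι) (hi : σ ∈ (x i).strings.periodicPart), (x i).param ⟨σ, hi⟩) ∧
        ((⨅ i, x i).strings = ⨅ i, (x i).strings ∧
          ∀ σ (hσ : σ ∈ (⨅ i, x i).strings.periodicPart),
            (⨅ i, x i).param ⟨σ, hσ⟩ =
              ⋂ (i : ι) (hi : σ ∈ (x i).strings.periodicPart), (x i).param ⟨σ, hi⟩) := by
  let L₀ := GentleStrings.crossingLattice hQ'.isGentle (Set.range f)
  let L := GentleStrings.ParamMaxNonCrossing.lattice hQ'.isGentle (Set.range f) B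
  refine ⟨L₀, L, fun _ _ => Iff.rfl, fun _ _ => Iff.rfl, fun ι x => ⟨?_, ?_⟩⟩
  · have h : ⨆ i, x i = GentleStrings.ParamMaxNonCrossing.withUnion x (⨆ i, (x i).strings) :=
      isLUB_iSup.unique
        (GentleStrings.ParamMaxNonCrossing.isLUB_withUnion hQ'.isGentle x isLUB_iSup)
    rw [h]
    exact ⟨rfl, fun _ _ => rfl⟩
  · have h : ⨅ i, x i = GentleStrings.ParamMaxNonCrossing.withInter x (⨅ i, (x i).strings) :=
      isGLB_iInf.unique
        (GentleStrings.ParamMaxNonCrossing.isGLB_withInter hQ'.isGentle x isGLB_iInf)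
    rw [h]
    exact ⟨rfl, fun _ _ => rfl⟩
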